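/- Let $A\in\mathbb{C}^{N\times N}$. For delays $m=(m_1,\dots,m_N)$, where each $m_i$ is a positive integer, let $$p_{A,m}(z)=\det\bigl(\operatorname{diag}(z^{m_1},\dots,z^{m_N})-A\bigr)$$ be the generalized characteristic polynomial of $A$. The matrix $A$ is called \emph{unilossless} if, for every choice of positive integer delays $m$, all complex roots of $p_{A,m}$ have modulus $1$. It is called \emph{irreducible} if there is no permutation matrix $P$ such that $P^{-1}AP=\begin{bmatrix}E&G\\0&F\end{bmatrix}$ with non-empty square diagonal blocks $E$ and $F$. If $A$ is irreducible and unilossless, then there exists a non-singular diagonal matrix $E\in\mathbb{C}^{N\times N}$ with $$A\,E\,A^{H}=E,$$ where $A^{H}$ denotes the conjugate transpose of $A$. -/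

import Mathlib

namespace FDN

open Polynomial

/-- The generalized characteristic polynomial `det (diag (z ^ m₁, …, z ^ m_N) - A)` of a feedback
matrix `A` with delays `m`. -/
noncomputable def genCharPoly {N : ℕ} (A : Matrix (Fin N) (Fin N) ℂ) (m : Fin N → ℕ) : ℂ[X] :=
  (Matrix.diagonal (fun i => (X : ℂ[X]) ^ m i) - A.map C).det

/-- A polynomial is lossless if all its complex roots have modulus `1`. -/
def IsLossless (p : ℂ[X]) : Prop :=
  ∀ z : ℂ, p.IsRoot z → ‖z‖ = 1

/-- `A` is unilossless if its generalized characteristic polynomial is lossless for every choice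
of (positive integer) delays. -/
def IsUnilossless {N : ℕ} (A : Matrix (Fin N) (Fin N) ℂ) : Prop :=
  ∀ m : Fin N → ℕ, (∀ i, 0 < m i) → IsLossless (genCharPoly A m)

/-- `A` is reducible if a simultaneous permutation of its rows and columns brings it to the block
triangular form `[E G; 0 F]` with non-empty square diagonal blocks `E` and `F`. -/
def IsReducible {N : ℕ} (A : Matrix (Fin N) (Fin N) ℂ) : Prop :=
  ∃ (r s : ℕ) (_ : 0 < r) (_ : 0 < s) (e : Fin r ⊕ Fin s ≃ Fin N)
    (E : Matrix (Fin r) (Fin r) ℂ) (G : Matrix (Fin r) (Fin s) ℂ) (F : Matrix (Fin s) (Fin s) ℂ),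
    A.submatrix e e = Matrix.fromBlocks E G 0 F

/-- `A` is irreducible if it is not reducible. -/
def IsIrreducible {N : ℕ} (A : Matrix (Fin N) (Fin N) ℂ) : Prop :=
  ¬ IsReducible A

end FDN

/-!
A unilossless matrix `A` makes `det (diag z - A)` free of zeros in the open unit polydisc: a point
with nonzero coordinates is a limit of points `(ζ ^ m₁, …, ζ ^ m_N)` with `‖ζ‖ < 1`, because for
`ζ = exp (-1 / q ^ 2 + 2 π i / q)` the size of `m i` relative to `q ^ 2` determines the modulus and
the residue of `m i` modulo `q` the phase. Hurwitz's theorem carries nonvanishing to the limit. The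
same holds for `A⁻¹`, so the Cayley transform turns a unimodular multiple of `A` into a bistable
matrix `R`.

Bistability forces real eigenvalues, also for `D R` with `D` a positive diagonal matrix, whence
`R a b * R b a ≥ 0`. It survives real diagonal shifts and pivots. The inequality for all
pivots at `j` says that a real quadratic polynomial is nonnegative, and its discriminant gives
`R i j * R j k * R k i = conj (R i k * R k j * R j i)`. If `R` has no zero entries, these
identities produce a diagonal `D` with `R D = D Rᴴ`. Otherwise strong connectivity provides pivots
that remove the zero entries one after another without creating new ones, and the property
`R D = D Rᴴ` can be transported back through them. It means `A D Aᴴ = D`.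
-/

namespace FDN

open Matrix Filter Topology

section Stability

variable {ι : Type*} [Fintype ι] [DecidableEq ι]

/-- `R` is stable if the multi-affine polynomial `det (diag x + R)` has no zeros in the product of
the open upper half planes. -/
def IsStable (R : Matrix ι ι ℂ) : Prop :=
  ∀ x : ι → ℂ, (∀ i, 0 < (x i).im) → (diagonal x + R).det ≠ 0

/-- `R` is bistable if `det (diag x + R)` has no zeros in the product of the open upper half planes
and none in the product of the open lower half planes; the latter is encoded as stability of
`-R`. -/
def IsBistable (R : Matrix ι ι ℂ) : Prop :=
  IsStable R ∧ IsStable (-R)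

variable {R : Matrix ι ι ℂ}

theorem IsStable.add_diagonal (h : IsStable R) (u : ι → ℝ) :
    IsStable (R + diagonal fun i => (u i : ℂ)) := by
  intro x hx
  have hshift := h (fun i => x i + u i) (by simpa using hx)
  rwa [← diagonal_add, add_assoc, add_comm _ R] at hshift

theorem IsBistable.add_diagonal (h : IsBistable R) (u : ι → ℝ) :
    IsBistable (R + diagonal fun i => (u i : ℂ)) := by
  refine ⟨h.1.add_diagonal u, ?_⟩
  have hneg : -(R + diagonal fun i => (u i : ℂ)) = -R + diagonal fun i => ((-u i : ℝ) : ℂ) := by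
    simp only [neg_add, diagonal_neg, Complex.ofReal_neg]
  exact hneg ▸ h.2.add_diagonal fun i => -u i

theorem IsStable.diagonal_mul (h : IsStable R) {y : ι → ℝ} (hy : ∀ i, 0 < y i) :
    IsStable (diagonal (fun i => (y i : ℂ)) * R) := by
  intro x hx
  have hy0 : ∀ i, (y i : ℂ) ≠ 0 := fun i => Complex.ofReal_ne_zero.2 (hy i).ne'
  have hfac : diagonal x + diagonal (fun i => (y i : ℂ)) * R
      = diagonal (fun i => (y i : ℂ)) * (diagonal (fun i => x i / y i) + R) := by
    simp only [mul_add, diagonal_mul_diagonal, mul_div_cancel₀ _ (hy0 _)]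
  rw [hfac, det_mul, det_diagonal]
  refine mul_ne_zero (Finset.prod_ne_zero_iff.2 fun i _ => hy0 i) (h _ fun i => ?_)
  rw [Complex.div_ofReal_im]
  exact div_pos (hx i) (hy i)

theorem IsBistable.diagonal_mul (h : IsBistable R) {y : ι → ℝ} (hy : ∀ i, 0 < y i) :
    IsBistable (diagonal (fun i => (y i : ℂ)) * R) :=
  ⟨h.1.diagonal_mul hy, mul_neg (diagonal fun i => (y i : ℂ)) R ▸ h.2.diagonal_mul hy⟩

theorem IsStable.im_nonneg_of_mem_spectrum (h : IsStable R) {z : ℂ} (hz : z ∈ spectrum ℂ R) :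
    0 ≤ z.im := by
  by_contra! hneg
  refine h (fun _ => -z) (fun _ => by simpa using hneg) ?_
  rw [mem_spectrum_iff_isRoot_charpoly, Polynomial.IsRoot, eval_charpoly] at hz
  have hfac : diagonal (fun _ => -z) + R = -(scalar ι z - R) := by
    rw [← diagonal_neg, scalar_apply]
    abel
  rw [hfac, det_neg, hz, mul_zero]

theorem IsBistable.im_eq_zero_of_mem_spectrum (h : IsBistable R) {z : ℂ}
    (hz : z ∈ spectrum ℂ R) : z.im = 0 := by
  have hneg : -z ∈ spectrum ℂ (-R) := by rwa [← spectrum.neg_eq, Set.neg_mem_neg]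
  have := h.2.im_nonneg_of_mem_spectrum hneg
  rw [Complex.neg_im] at this
  linarith [h.1.im_nonneg_of_mem_spectrum hz]

theorem IsBistable.im_trace_eq_zero (h : IsBistable R) : (trace R).im = 0 := by
  rw [trace_eq_sum_roots_charpoly]
  refine Multiset.sum_induction (fun z : ℂ => z.im = 0) _ (fun a b ha hb => by simp [ha, hb])
    rfl fun z hz => h.im_eq_zero_of_mem_spectrum ?_
  exact mem_spectrum_iff_isRoot_charpoly.2 (Polynomial.mem_roots'.1 hz).2

open scoped ComplexOrder in
theorem IsBistable.trace_sq_nonneg (h : IsBistable R) : 0 ≤ trace (R ^ 2) := by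
  rw [trace_eq_sum_roots_charpoly]
  refine Multiset.sum_induction (0 ≤ ·) _ (fun _ _ => add_nonneg) le_rfl fun z hz => ?_
  have hz' := mem_spectrum_iff_isRoot_charpoly.2 (Polynomial.mem_roots'.1 hz).2
  rw [spectrum.map_pow_of_pos _ two_pos] at hz'
  obtain ⟨w, hw, rfl⟩ := hz'
  exact Complex.sq_nonneg_iff.2 (h.im_eq_zero_of_mem_spectrum hw)

theorem IsBistable.im_diag_eq_zero (h : IsBistable R) (a : ι) : (R a a).im = 0 := by
  have hpos : ∀ i, 0 < 1 + (Pi.single a 1 : ι → ℝ) i := fun i =>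
    add_pos_of_pos_of_nonneg one_pos ((Pi.single_nonneg.2 zero_le_one : (0 : ι → ℝ) ≤ _) i)
  have hsum : trace (diagonal (fun i => ((1 + (Pi.single a 1 : ι → ℝ) i : ℝ) : ℂ)) * R)
      = trace R + R a a := by
    simp only [trace, diag_apply, Matrix.diagonal_mul, Complex.ofReal_add, Complex.ofReal_one,
      add_mul, one_mul, Finset.sum_add_distrib, Pi.single_apply, apply_ite Complex.ofReal,
      Complex.ofReal_zero, ite_mul, zero_mul, Finset.sum_ite_eq', Finset.mem_univ, if_true]
  have htrace := (h.diagonal_mul hpos).im_trace_eq_zero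
  rwa [hsum, Complex.add_im, h.im_trace_eq_zero, zero_add] at htrace

theorem IsBistable.ofReal_re_diag (h : IsBistable R) (a : ι) : ((R a a).re : ℂ) = R a a :=
  Complex.ext rfl (h.im_diag_eq_zero a).symm

theorem IsBistable.exists_diag_eq (h : IsBistable R) (v : ℝ) :
    ∃ u : ι → ℝ, ∀ i, (R + diagonal fun i => (u i : ℂ)) i i = v :=
  ⟨fun i => v - (R i i).re, fun i => by simp [h.ofReal_re_diag]⟩

theorem trace_diagonal_mul_sq (y : ι → ℂ) (R : Matrix ι ι ℂ) :
    trace ((diagonal y * R) ^ 2) = ∑ i, ∑ j, y i * y j * (R i j * R j i) := by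
  simp only [trace, diag_apply, pow_two]
  refine Finset.sum_congr rfl fun i _ => ?_
  rw [Matrix.mul_apply]
  refine Finset.sum_congr rfl fun j _ => ?_
  rw [diagonal_mul, diagonal_mul]
  ring

open scoped ComplexOrder in
theorem IsBistable.trace_diagonal_mul_sq_nonneg (h : IsBistable R) {y : ι → ℝ}
    (hy : ∀ i, 0 ≤ y i) : 0 ≤ trace ((diagonal (fun i => (y i : ℂ)) * R) ^ 2) := by
  have hc : Continuous fun ε : ℝ => trace ((diagonal (fun i => ((y i + ε : ℝ) : ℂ)) * R) ^ 2) := by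
    simp only [trace_diagonal_mul_sq]
    fun_prop
  have hlim := (hc.tendsto 0).mono_left (nhdsWithin_le_nhds (s := Set.Ioi 0))
  simp only [add_zero] at hlim
  refine ge_of_tendsto hlim ?_
  filter_upwards [self_mem_nhdsWithin] with ε hε
  exact (h.diagonal_mul fun i => add_pos_of_nonneg_of_pos (hy i) hε).trace_sq_nonneg

open scoped ComplexOrder in
theorem IsBistable.mul_apply_nonneg (h : IsBistable R) (a b : ι) : 0 ≤ R a b * R b a := by
  rcases eq_or_ne a b with rfl | hab
  · rw [← pow_two]
    exact Complex.sq_nonneg_iff.2 (h.im_diag_eq_zero a)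
  obtain ⟨u, hu⟩ := h.exists_diag_eq 0
  set S := R + diagonal fun i => (u i : ℂ) with hS
  have hab' : S a b = R a b ∧ S b a = R b a := by simp [hS, hab, hab.symm]
  let y : ι → ℝ := Pi.single a 1 + Pi.single b 1
  have hy : 0 ≤ y := add_nonneg (Pi.single_nonneg.2 zero_le_one) (Pi.single_nonneg.2 zero_le_one)
  have hsum : trace ((diagonal (fun i => (y i : ℂ)) * S) ^ 2) = 2 * (R a b * R b a) := by
    simp only [trace_diagonal_mul_sq, y, Pi.add_apply, Pi.single_apply, Complex.ofReal_add,
      apply_ite Complex.ofReal, Complex.ofReal_one, Complex.ofReal_zero, add_mul, mul_add, ite_mul,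
      mul_ite, one_mul, zero_mul, mul_one, mul_zero, Finset.sum_add_distrib, Finset.sum_ite_eq',
      Finset.mem_univ, if_true, hu, hab', add_zero, zero_add]
    ring
  have hnonneg := (h.add_diagonal u).trace_diagonal_mul_sq_nonneg hy
  rw [hsum] at hnonneg
  exact le_of_mul_le_mul_left (by rwa [mul_zero]) (two_pos (α := ℂ))

theorem IsBistable.star_mul_apply (h : IsBistable R) (a b : ι) :
    star (R a b * R b a) = R a b * R b a := by
  open scoped ComplexOrder in
  exact IsSelfAdjoint.of_nonneg (h.mul_apply_nonneg a b)

end Stability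

section Pivot

variable {ι : Type*} [Fintype ι] [DecidableEq ι] {R : Matrix ι ι ℂ}

/-- The rank-one update `R - t R e_b e_bᵀ R`, the elementary move of the argument. If `R` is
invertible, it is the inverse of `R⁻¹ + t e_b e_bᵀ` when `R b b = 0`. -/
def pivot (R : Matrix ι ι ℂ) (b : ι) (t : ℝ) : Matrix ι ι ℂ :=
  R - (t : ℂ) • (R * single b b 1 * R)

theorem pivot_apply (R : Matrix ι ι ℂ) (b : ι) (t : ℝ) (i j : ι) :
    pivot R b t i j = R i j - t * (R i b * R b j) := by
  have hrank : R * single b b 1 * R = vecMulVec (R.col b) (R.row b) := by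
    rw [single_eq_single_vecMulVec_single, mul_vecMulVec, vecMulVec_mul, mulVec_single_one,
      single_one_vecMul]
  rw [pivot, hrank]
  rfl

theorem pivot_neg (R : Matrix ι ι ℂ) (b : ι) (t : ℝ) : pivot (-R) b t = -pivot R b (-t) := by
  simp only [pivot, neg_mul, mul_neg, neg_neg, Complex.ofReal_neg, neg_smul, neg_sub]
  abel

theorem pivot_pivot_neg {b : ι} (hb : R b b = 0) (t : ℝ) :
    pivot (pivot R b t) b (-t) = R := by
  ext i j
  simp only [pivot_apply, hb, Complex.ofReal_neg]
  ring

theorem one_add_mul_ne_zero (t : ℝ) {x : ℂ} (hx : 0 < x.im) : 1 + t * x ≠ 0 := by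
  rcases eq_or_ne t 0 with rfl | ht
  · simp
  · refine fun h => mul_ne_zero ht hx.ne' ?_
    simpa using congrArg Complex.im h

theorem im_div_one_add_mul_pos (t : ℝ) {x : ℂ} (hx : 0 < x.im) : 0 < (x / (1 + t * x)).im := by
  have him : (x / (1 + t * x)).im = x.im / Complex.normSq (1 + t * x) := by
    rw [Complex.div_im]
    simp only [Complex.add_re, Complex.add_im, Complex.one_re, Complex.one_im,
      Complex.re_ofReal_mul, Complex.im_ofReal_mul]
    ring
  rw [him]
  exact div_pos hx (Complex.normSq_pos.2 (one_add_mul_ne_zero t hx))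

theorem single_mul_mul_single_mul {b : ι} (hb : R b b = 0) :
    single b b 1 * R * (single b b 1 * R) = 0 := by
  rw [← mul_assoc, single_mul_mul_single, hb, mul_zero, zero_mul, single_zero, zero_mul]

theorem det_one_sub_smul_single_mul_ne_zero {b : ι} (hb : R b b = 0) (t : ℂ) :
    (1 - t • (single b b 1 * R)).det ≠ 0 := by
  refine det_ne_zero_of_right_inverse (B := 1 + t • (single b b 1 * R)) ?_
  simp only [sub_mul, mul_add, smul_mul_assoc, mul_smul_comm, single_mul_mul_single_mul hb,
    smul_zero, one_mul, mul_one, sub_zero, sub_add_cancel]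

open Function in
/-- Pivoting amounts to the substitution `x_b ↦ x_b / (1 + t x_b)`, which preserves the upper half
plane. -/
theorem IsStable.pivot (h : IsStable R) {b : ι} (hb : R b b = 0) (t : ℝ) :
    IsStable (pivot R b t) := by
  intro x hx
  set E : Matrix ι ι ℂ := single b b 1 with hE
  set y := update x b (x b / (1 + t * x b)) with hy
  have hypos : ∀ i, 0 < (y i).im :=
    (forall_update_iff x fun _ w => 0 < w.im).2
      ⟨im_div_one_add_mul_pos t (hx b), fun i _ => hx i⟩
  have hxy : (1 + (t : ℂ) • (diagonal x * E)) * diagonal y = diagonal x := by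
    rw [hE, ← diagonal_single, diagonal_mul_diagonal, ← diagonal_smul, ← diagonal_one,
      diagonal_add, diagonal_mul_diagonal]
    congr 1
    ext i
    rcases eq_or_ne i b with rfl | hi
    · simp [hy, mul_div_cancel₀ _ (one_add_mul_ne_zero t (hx i))]
    · simp [hy, hi]
  have hfac : diagonal x + FDN.pivot R b t
      = (1 + (t : ℂ) • (diagonal x * E)) * (diagonal y + R) * (1 - (t : ℂ) • (E * R)) := by
    have hsq : E * (R * (E * R)) = 0 := by
      rw [← mul_assoc, single_mul_mul_single_mul hb]
    rw [mul_add, hxy]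
    simp only [FDN.pivot, add_mul, mul_sub, one_mul, mul_one, smul_mul_assoc, mul_smul_comm,
      mul_assoc, hsq, mul_zero, smul_zero, smul_add, E]
    abel
  rw [hfac, det_mul, det_mul]
  refine mul_ne_zero (mul_ne_zero ?_ (h y hypos)) (det_one_sub_smul_single_mul_ne_zero hb t)
  refine left_ne_zero_of_mul (b := (diagonal y).det) ?_
  rw [← det_mul, hxy, det_diagonal]
  exact Finset.prod_ne_zero_iff.2 fun i _ hi => (hx i).ne' (by rw [hi, Complex.zero_im])

theorem IsBistable.pivot (h : IsBistable R) {b : ι} (hb : R b b = 0) (t : ℝ) :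
    IsBistable (pivot R b t) := by
  refine ⟨h.1.pivot hb t, ?_⟩
  have hneg := h.2.pivot (b := b) (by rw [Matrix.neg_apply, hb, neg_zero]) (-t)
  rwa [pivot_neg, neg_neg] at hneg

end Pivot

section Symmetrizer

variable {ι : Type*} [Fintype ι] [DecidableEq ι] {R : Matrix ι ι ℂ}

open scoped ComplexOrder in
theorem mul_eq_star_mul_of_forall_nonneg {a b p q : ℂ}
    (h : ∀ τ : ℝ, 0 ≤ (a - τ * p) * (b - τ * q)) : b * p = star (a * q) := by
  have hexp : ∀ τ : ℝ, (a - τ * p) * (b - τ * q)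
      = ((τ * τ : ℝ) : ℂ) * (p * q) - τ * (a * q + b * p) + a * b := fun τ => by
    push_cast
    ring
  have him : ∀ τ : ℝ, τ * τ * (p * q).im - τ * (a * q + b * p).im + (a * b).im = 0 := fun τ => by
    have := (Complex.nonneg_iff.1 (hexp τ ▸ h τ)).2
    rw [Complex.add_im, Complex.sub_im, Complex.im_ofReal_mul, Complex.im_ofReal_mul] at this
    exact this.symm
  have hre : ∀ τ : ℝ, 0 ≤ (p * q).re * (τ * τ) + -(a * q + b * p).re * τ + (a * b).re := fun τ => by
    have := (Complex.nonneg_iff.1 (hexp τ ▸ h τ)).1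
    rw [Complex.add_re, Complex.sub_re, Complex.re_ofReal_mul, Complex.re_ofReal_mul] at this
    linarith
  have hab : (a * b).im = 0 := by linarith [him 0]
  have hpq : (p * q).im = 0 := by linarith [him 1, him (-1)]
  have hsum : (a * q + b * p).im = 0 := by linarith [him 1]
  have hsq : (a * q - b * p) ^ 2 = (discrim (p * q).re (-(a * q + b * p).re) (a * b).re : ℝ) := by
    have hofReal : ∀ {z : ℂ}, z.im = 0 → (z.re : ℂ) = z := fun hz => Complex.ext rfl hz.symm
    rw [discrim]
    push_cast
    rw [hofReal hpq, hofReal hsum, hofReal hab]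
    ring
  have hdiff : (a * q - b * p).re = 0 := by
    rw [← Complex.sq_nonpos_iff, hsq]
    exact_mod_cast discrim_le_zero hre
  rw [Complex.add_im] at hsum
  rw [Complex.sub_re] at hdiff
  apply Complex.ext
  · rw [Complex.star_def, Complex.conj_re]
    linarith
  · rw [Complex.star_def, Complex.conj_im]
    linarith

theorem IsBistable.triangle_of_diag_eq_zero (h : IsBistable R) {j : ι} (hj : R j j = 0) (i k : ι) :
    R i j * R j k * R k i = star (R i k * R k j * R j i) := by
  open scoped ComplexOrder in
  have hpivot : ∀ τ : ℝ, 0 ≤ (R i k - τ * (R i j * R j k)) * (R k i - τ * (R k j * R j i)) :=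
    fun τ => by simpa only [pivot_apply] using (h.pivot hj τ).mul_apply_nonneg i k
  rw [mul_assoc (R i k), ← mul_eq_star_mul_of_forall_nonneg hpivot]
  ring

theorem IsBistable.triangle (h : IsBistable R) (i j k : ι) :
    R i j * R j k * R k i = star (R i k * R k j * R j i) := by
  have hdiag : ∀ l, star (R l l) = R l l := fun l => Complex.conj_eq_iff_im.2 (h.im_diag_eq_zero l)
  rcases eq_or_ne i j with rfl | hij
  · rw [star_mul', h.star_mul_apply, hdiag]
    ring
  rcases eq_or_ne j k with rfl | hjk
  · rw [mul_right_comm, star_mul', h.star_mul_apply, hdiag]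
  rcases eq_or_ne i k with rfl | hik
  · rw [mul_assoc (R i i), star_mul', h.star_mul_apply, hdiag, mul_comm]
  obtain ⟨u, hu⟩ := h.exists_diag_eq 0
  have hshift := (h.add_diagonal u).triangle_of_diag_eq_zero (j := j) (by exact_mod_cast hu j) i k
  simpa only [Matrix.add_apply, diagonal_apply_ne _ hij, diagonal_apply_ne _ hij.symm,
    diagonal_apply_ne _ hjk, diagonal_apply_ne _ hjk.symm, diagonal_apply_ne _ hik,
    diagonal_apply_ne _ hik.symm, add_zero] using hshift

/-- `R` is symmetrizable if `R D = D Rᴴ` for some invertible diagonal matrix `D`; this is what the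
conclusion `A D Aᴴ = D` becomes under the Cayley transform. -/
def IsSymmetrizable (R : Matrix ι ι ℂ) : Prop :=
  ∃ d : ι → ℂ, (∀ i, d i ≠ 0) ∧ R * diagonal d = diagonal d * Rᴴ

theorem IsSymmetrizable.add_diagonal (h : IsSymmetrizable R) (u : ι → ℝ) :
    IsSymmetrizable (R + diagonal fun i => (u i : ℂ)) := by
  obtain ⟨d, hd, hR⟩ := h
  refine ⟨d, hd, ?_⟩
  have hstar : star (fun i => (u i : ℂ)) = fun i => (u i : ℂ) :=
    funext fun i => Complex.conj_ofReal (u i)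
  rw [conjTranspose_add, diagonal_conjTranspose, hstar, add_mul, mul_add, hR,
    (commute_diagonal _ d).eq]

theorem IsSymmetrizable.of_add_diagonal {u : ι → ℝ}
    (h : IsSymmetrizable (R + diagonal fun i => (u i : ℂ))) : IsSymmetrizable R := by
  simpa [add_assoc] using h.add_diagonal (-u)

theorem IsSymmetrizable.pivot (h : IsSymmetrizable R) (b : ι) (t : ℝ) :
    IsSymmetrizable (pivot R b t) := by
  obtain ⟨d, hd, hR⟩ := h
  have hentry : ∀ i j, R i j * d j = d i * star (R j i) := fun i j => by
    simpa only [mul_diagonal, Matrix.diagonal_mul, conjTranspose_apply] using congrFun₂ hR i j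
  refine ⟨d, hd, Matrix.ext fun i j => ?_⟩
  have hstar : star (t : ℂ) = t := Complex.conj_ofReal t
  rw [mul_diagonal, Matrix.diagonal_mul, conjTranspose_apply, pivot_apply, pivot_apply, star_sub,
    star_mul', star_mul', hstar]
  linear_combination hentry i j - t * R i b * hentry b j - t * star (R j b) * hentry i b

theorem IsSymmetrizable.of_pivot {b : ι} (hb : R b b = 0) {t : ℝ}
    (h : IsSymmetrizable (FDN.pivot R b t)) : IsSymmetrizable R :=
  pivot_pivot_neg hb t ▸ h.pivot b (-t)

theorem IsBistable.isSymmetrizable_of_ne_zero (h : IsBistable R) (hne : ∀ i j, R i j ≠ 0) :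
    IsSymmetrizable R := by
  rcases isEmpty_or_nonempty ι with _ | ⟨⟨o⟩⟩
  · exact ⟨0, isEmptyElim, Subsingleton.elim _ _⟩
  have hd : ∀ j, R j o / star (R o j) = star (R j o) / R o j := fun j => by
    rw [div_eq_div_iff (star_ne_zero.2 (hne o j)) (hne o j), ← star_mul', h.star_mul_apply]
  refine ⟨fun j => star (R j o) / R o j, fun j => div_ne_zero (star_ne_zero.2 (hne j o)) (hne o j),
    Matrix.ext fun i j => ?_⟩
  rw [mul_diagonal, Matrix.diagonal_mul, conjTranspose_apply, ← hd j, mul_div_assoc',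
    div_mul_eq_mul_div, div_eq_div_iff (star_ne_zero.2 (hne o j)) (hne o i), h.triangle, star_mul',
    star_mul']
  ring

end Symmetrizer

section StrongConnectivity

variable {ι : Type*} {R : Matrix ι ι ℂ}

/-- The directed graph with an edge from `i` to `j` whenever `R i j ≠ 0` is strongly connected: no
proper nonempty set of vertices is closed under following edges. -/
def IsStronglyConnected (R : Matrix ι ι ℂ) : Prop :=
  ∀ S : Set ι, S.Nonempty → (∀ i ∈ S, ∀ j ∉ S, R i j = 0) → S = Set.univ

/-- The positions of the vanishing off-diagonal entries of `R`. Its strict decrease under suitable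
pivots is what makes the induction terminate. -/
def offDiagZeros (R : Matrix ι ι ℂ) : Set (ι × ι) :=
  {p | p.1 ≠ p.2 ∧ R p.1 p.2 = 0}

theorem offDiagZeros_add_diagonal [DecidableEq ι] (R : Matrix ι ι ℂ) (u : ι → ℂ) :
    offDiagZeros (R + diagonal u) = offDiagZeros R := by
  ext p
  refine and_congr_right fun hp => ?_
  rw [Matrix.add_apply, diagonal_apply_ne _ hp, add_zero]

theorem IsStronglyConnected.of_offDiagZeros_subset {S : Matrix ι ι ℂ} (h : IsStronglyConnected R)
    (hSR : offDiagZeros S ⊆ offDiagZeros R) : IsStronglyConnected S := fun T hT hS =>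
  h T hT fun i hi j hj =>
    (@hSR (i, j) ⟨ne_of_mem_of_not_mem hi hj, hS i hi j hj⟩).2

theorem IsStronglyConnected.exists_path_of_apply_eq_zero (h : IsStronglyConnected R) {i j : ι}
    (hij : i ≠ j) (h0 : R i j = 0) :
    ∃ b c, i ≠ c ∧ R i b ≠ 0 ∧ R b c ≠ 0 ∧ R i c = 0 := by
  by_contra! hno
  have huniv : insert i {l | R i l ≠ 0} = Set.univ := by
    refine h _ (Set.insert_nonempty _ _) fun b hb c hc => ?_
    obtain ⟨hci, hic⟩ : c ≠ i ∧ R i c = 0 := by simpa [not_or] using hc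
    rcases hb with rfl | hb
    · exact hic
    · by_contra hbc
      exact hno b c hci.symm hb hbc hic
  have hj : j ∈ insert i {l | R i l ≠ 0} := huniv ▸ Set.mem_univ j
  exact hj.elim hij.symm fun hj => hj h0

theorem IsStronglyConnected.of_mul_eq_one [Fintype ι] [DecidableEq ι] {S : Matrix ι ι ℂ}
    (h : IsStronglyConnected R) (hSR : S * R = 1) : IsStronglyConnected S := by
  classical
  intro T hT hST
  refine h T hT ?_
  let b : ι → ℕ := fun i => if i ∈ T then 1 else 0
  have hb : ∀ i j, b j < b i ↔ i ∈ T ∧ j ∉ T := fun i j => by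
    by_cases hi : i ∈ T <;> by_cases hj : j ∈ T <;> simp [b, hi, hj]
  have htri : BlockTriangular S b := fun i j hij =>
    hST i ((hb i j).1 hij).1 j ((hb i j).1 hij).2
  let _ := invertibleOfRightInverse S R hSR
  have hinv := blockTriangular_inv_of_blockTriangular htri
  rw [inv_eq_right_inv hSR] at hinv
  exact fun i hi j hj => hinv ((hb i j).2 ⟨hi, hj⟩)

variable [Fintype ι] [DecidableEq ι]

theorem exists_pivot_apply_ne_zero {i b c : ι} (hib : R i b ≠ 0) (hbc : R b c ≠ 0)
    (hic : R i c = 0) :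
    ∃ t : ℝ, pivot R b t i c ≠ 0 ∧ ∀ k l, R k l ≠ 0 → pivot R b t k l ≠ 0 := by
  have hkeep : ∀ᶠ t : ℝ in 𝓝[≠] 0, ∀ k l, R k l ≠ 0 → pivot R b t k l ≠ 0 := by
    simp only [eventually_all]
    refine fun k l hkl => ContinuousAt.eventually_ne ?_ ?_ |>.filter_mono nhdsWithin_le_nhds
    · simp only [pivot_apply]
      fun_prop
    · simpa [pivot_apply] using hkl
  obtain ⟨t, ht, ht0⟩ := (hkeep.and self_mem_nhdsWithin).exists
  refine ⟨t, ?_, ht⟩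
  rw [pivot_apply, hic, zero_sub, neg_ne_zero]
  exact mul_ne_zero (Complex.ofReal_ne_zero.2 ht0) (mul_ne_zero hib hbc)

theorem IsStronglyConnected.exists_pivot_offDiagZeros_ssubset (h : IsStronglyConnected R)
    {p : ι × ι} (hp : p ∈ offDiagZeros R) :
    ∃ b t, offDiagZeros (pivot R b t) ⊂ offDiagZeros R := by
  obtain ⟨b, c, hic, hib, hbc, hzero⟩ := h.exists_path_of_apply_eq_zero hp.1 hp.2
  obtain ⟨t, ht, hkeep⟩ := exists_pivot_apply_ne_zero hib hbc hzero
  refine ⟨b, t, (Set.ssubset_iff_of_subset ?_).2 ⟨(p.1, c), ⟨hic, hzero⟩, fun hmem => ht hmem.2⟩⟩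
  exact fun q hq => ⟨hq.1, by_contra fun hne => hkeep q.1 q.2 hne hq.2⟩

theorem IsBistable.isSymmetrizable (h : IsBistable R) (hc : IsStronglyConnected R) :
    IsSymmetrizable R := by
  induction hZ : offDiagZeros R using WellFoundedLT.induction generalizing R with
  | ind Z ih =>
    subst hZ
    rcases (offDiagZeros R).eq_empty_or_nonempty with hempty | ⟨p, hp⟩
    · obtain ⟨u, hu⟩ := h.exists_diag_eq 1
      refine .of_add_diagonal ((h.add_diagonal u).isSymmetrizable_of_ne_zero fun i j h0 => ?_)
      rcases eq_or_ne i j with rfl | hij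
      · simp [hu i] at h0
      · have hmem : (i, j) ∈ offDiagZeros (R + diagonal fun i => (u i : ℂ)) := ⟨hij, h0⟩
        rwa [offDiagZeros_add_diagonal, hempty] at hmem
    · obtain ⟨u, hu⟩ := h.exists_diag_eq 0
      set S := R + diagonal fun i => (u i : ℂ)
      have hZ : offDiagZeros S = offDiagZeros R := offDiagZeros_add_diagonal R _
      have hS : IsStronglyConnected S := hc.of_offDiagZeros_subset hZ.subset
      obtain ⟨b, t, hlt⟩ := hS.exists_pivot_offDiagZeros_ssubset (hZ ▸ hp)
      have hb : S b b = 0 := by exact_mod_cast hu b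
      exact .of_add_diagonal <| .of_pivot hb <|
        ih _ (hZ ▸ hlt) ((h.add_diagonal u).pivot hb t) (hS.of_offDiagZeros_subset hlt.subset) rfl

end StrongConnectivity

section Cayley

variable {ι : Type*} [Fintype ι] [DecidableEq ι] {A B R D : Matrix ι ι ℂ}

/-- `A` is polydisc stable if `det (diag z - A)` has no zeros in the open unit polydisc. -/
def IsPolydiscStable (A : Matrix ι ι ℂ) : Prop :=
  ∀ z : ι → ℂ, (∀ i, ‖z i‖ < 1) → (diagonal z - A).det ≠ 0

theorem IsPolydiscStable.det_ne_zero (h : IsPolydiscStable A) : A.det ≠ 0 := by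
  have h0 := h 0 fun _ => by simp
  rw [diagonal_zero', zero_sub, det_neg] at h0
  exact right_ne_zero_of_mul h0

theorem IsPolydiscStable.smul (h : IsPolydiscStable A) {c : ℂ} (hc : ‖c‖ = 1) :
    IsPolydiscStable (c • A) := by
  intro z hz
  have hc0 : c ≠ 0 := norm_ne_zero_iff.1 (hc ▸ one_ne_zero)
  have hfac : diagonal z - c • A = c • (diagonal (c⁻¹ • z) - A) := by
    rw [smul_sub, ← diagonal_smul, smul_inv_smul₀ hc0]
  rw [hfac, det_smul]
  refine mul_ne_zero (pow_ne_zero _ hc0) (h _ fun i => ?_)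
  rw [Pi.smul_apply, norm_smul, norm_inv, hc, inv_one, one_mul]
  exact hz i

theorem exists_norm_eq_one_det_one_sub_smul_ne_zero (A : Matrix ι ι ℂ) :
    ∃ c : ℂ, ‖c‖ = 1 ∧ (1 - c • A).det ≠ 0 := by
  have hinf : (Metric.sphere (0 : ℂ) 1).Infinite :=
    (isPreconnected_sphere (by simp) 0 1).infinite_of_nontrivial
      ⟨1, by simp, -1, by simp, by norm_num⟩
  obtain ⟨w, hw, hroot⟩ := hinf.exists_notMem_finset A.charpoly.roots.toFinset
  rw [mem_sphere_zero_iff_norm] at hw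
  refine ⟨w⁻¹, by rw [norm_inv, hw, inv_one], fun h0 => hroot ?_⟩
  rw [Multiset.mem_toFinset, Polynomial.mem_roots A.charpoly_monic.ne_zero, Polynomial.IsRoot,
    eval_charpoly]
  have hw0 : w ≠ 0 := norm_ne_zero_iff.1 (hw ▸ one_ne_zero)
  have hfac : scalar ι w - A = w • (1 - w⁻¹ • A) := by
    rw [smul_sub, smul_inv_smul₀ hw0, smul_one_eq_diagonal, scalar_apply]
  rw [hfac, det_smul, h0, mul_zero]

theorem add_I_ne_zero {x : ℂ} (hx : 0 < x.im) : x + Complex.I ≠ 0 := fun h0 => by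
  have him := congrArg Complex.im h0
  rw [Complex.add_im, Complex.I_im, Complex.zero_im] at him
  linarith

theorem norm_sub_I_div_add_I_lt_one {x : ℂ} (hx : 0 < x.im) :
    ‖(x - Complex.I) / (x + Complex.I)‖ < 1 := by
  rw [norm_div, div_lt_one (norm_pos_iff.2 (add_I_ne_zero hx)),
    ← sq_lt_sq₀ (norm_nonneg _) (norm_nonneg _), ← Complex.normSq_eq_norm_sq,
    ← Complex.normSq_eq_norm_sq]
  simp only [Complex.normSq_apply, Complex.sub_re, Complex.sub_im, Complex.add_re,
    Complex.add_im, Complex.I_re, Complex.I_im]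
  linarith

/-- The Cayley transform `-i (1 + B) (1 - B)⁻¹`, which carries the polydisc to the product of half
planes. It is only meaningful when `1 - B` is invertible. -/
noncomputable def cayley (B : Matrix ι ι ℂ) : Matrix ι ι ℂ :=
  Complex.I • (1 - (2 : ℂ) • (1 - B)⁻¹)

theorem cayley_mul_one_sub (hB : IsUnit (1 - B).det) :
    cayley B * (1 - B) = -(Complex.I • (1 + B)) := by
  rw [cayley, smul_mul_assoc, sub_mul, smul_mul_assoc, nonsing_inv_mul _ hB, one_mul]
  module

theorem IsPolydiscStable.isStable (h : IsPolydiscStable B)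
    (hR : R * (1 - B) = -(Complex.I • (1 + B))) : IsStable R := by
  intro x hx hdet
  have hfac : diagonal (fun i => x i + Complex.I)
        * (diagonal (fun i => (x i - Complex.I) / (x i + Complex.I)) - B)
      = (diagonal x + R) * (1 - B) := by
    have hadd : diagonal (fun i => x i + Complex.I) = diagonal x + Complex.I • 1 := by
      rw [← diagonal_add, smul_one_eq_diagonal]
    have hsub : diagonal (fun i => x i + Complex.I)
          * diagonal (fun i => (x i - Complex.I) / (x i + Complex.I))
        = diagonal x - Complex.I • 1 := by
      simp only [diagonal_mul_diagonal, mul_div_cancel₀ _ (add_I_ne_zero (hx _)), ← diagonal_sub,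
        smul_one_eq_diagonal]
    rw [mul_sub, hsub, hadd, add_mul, add_mul, hR, smul_mul_assoc, one_mul, mul_sub, mul_one]
    module
  have hdet_eq := congrArg det hfac
  rw [det_mul, det_mul, hdet, zero_mul, det_diagonal] at hdet_eq
  exact mul_ne_zero (Finset.prod_ne_zero_iff.2 fun i _ => add_I_ne_zero (hx i))
    (h _ fun i => norm_sub_I_div_add_I_lt_one (hx i)) hdet_eq

theorem IsPolydiscStable.isBistable_cayley (h : IsPolydiscStable B) (h' : IsPolydiscStable B⁻¹)
    (hB : IsUnit (1 - B).det) : IsBistable (cayley B) := by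
  refine ⟨h.isStable (cayley_mul_one_sub hB), h'.isStable ?_⟩
  have hdet : IsUnit B.det := h.det_ne_zero.isUnit
  calc -cayley B * (1 - B⁻¹) = cayley B * (1 - B) * B⁻¹ := by
        rw [mul_assoc, sub_mul, mul_nonsing_inv B hdet, one_mul, neg_mul, ← mul_neg, neg_sub]
    _ = -(Complex.I • (1 + B⁻¹)) := by
        rw [cayley_mul_one_sub hB, neg_mul, smul_mul_assoc, add_mul, mul_nonsing_inv B hdet,
          one_mul, add_comm]

theorem IsStronglyConnected.cayley (h : IsStronglyConnected B) (hB : IsUnit (1 - B).det) :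
    IsStronglyConnected (cayley B) := by
  have hsub : IsStronglyConnected (1 - B) := h.of_offDiagZeros_subset fun p hp =>
    ⟨hp.1, by simpa [one_apply_ne hp.1] using hp.2⟩
  refine (hsub.of_mul_eq_one (nonsing_inv_mul _ hB)).of_offDiagZeros_subset fun p hp => ⟨hp.1, ?_⟩
  simpa [FDN.cayley, one_apply_ne hp.1] using hp.2

theorem mul_mul_conjTranspose_eq_of_cayley (hB : IsUnit (1 - B).det)
    (hD : cayley B * D = D * (cayley B)ᴴ) : B * D * Bᴴ = D := by
  set W := (1 - B)⁻¹
  have hsum : W * D + D * Wᴴ = D := by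
    have hI : Complex.I • (D - (2 : ℂ) • (W * D)) = -(Complex.I • (D - (2 : ℂ) • (D * Wᴴ))) := by
      simpa only [cayley, conjTranspose_smul, conjTranspose_sub, conjTranspose_one, smul_mul_assoc,
        mul_smul_comm, sub_mul, mul_sub, one_mul, mul_one, Complex.star_def, Complex.conj_I,
        neg_smul, mul_neg, Complex.conj_ofNat] using hD
    rw [← smul_neg, smul_right_inj Complex.I_ne_zero] at hI
    refine smul_right_injective _ (two_ne_zero (α := ℂ)) ?_
    linear_combination (norm := module) (-1 : ℂ) • hI
  have hleft : (1 - B) * W = 1 := mul_nonsing_inv _ hB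
  have hright : Wᴴ * (1 - B)ᴴ = 1 := by rw [← conjTranspose_mul, hleft, conjTranspose_one]
  have hexp : (1 - B) * D * (1 - B)ᴴ = D * (1 - B)ᴴ + (1 - B) * D := by
    calc (1 - B) * D * (1 - B)ᴴ = (1 - B) * (W * D + D * Wᴴ) * (1 - B)ᴴ := by rw [hsum]
      _ = (1 - B) * W * D * (1 - B)ᴴ + (1 - B) * D * (Wᴴ * (1 - B)ᴴ) := by noncomm_ring
      _ = D * (1 - B)ᴴ + (1 - B) * D := by rw [hleft, hright, one_mul, mul_one]
  rw [conjTranspose_sub, conjTranspose_one] at hexp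
  calc B * D * Bᴴ = (1 - B) * D * (1 - Bᴴ) - (D * (1 - Bᴴ) + (1 - B) * D) + D := by noncomm_ring
    _ = D := by rw [hexp, sub_self, zero_add]

theorem IsPolydiscStable.exists_mul_mul_conjTranspose_eq (h : IsPolydiscStable A)
    (h' : IsPolydiscStable A⁻¹) (hc : IsStronglyConnected A) :
    ∃ d : ι → ℂ, (∀ i, d i ≠ 0) ∧ A * diagonal d * Aᴴ = diagonal d := by
  obtain ⟨c, hc1, hdet⟩ := exists_norm_eq_one_det_one_sub_smul_ne_zero A
  have hc0 : c ≠ 0 := norm_ne_zero_iff.1 (hc1 ▸ one_ne_zero)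
  have hinv : (c • A)⁻¹ = c⁻¹ • A⁻¹ := inv_smul' A (Units.mk0 c hc0) h.det_ne_zero.isUnit
  have hstable' : IsPolydiscStable (c • A)⁻¹ := hinv ▸ h'.smul (by rw [norm_inv, hc1, inv_one])
  have hconn : IsStronglyConnected (c • A) := hc.of_offDiagZeros_subset fun p hp =>
    ⟨hp.1, (smul_eq_zero_iff_right hc0).1 hp.2⟩
  obtain ⟨d, hd, hsymm⟩ :=
    ((h.smul hc1).isBistable_cayley hstable' hdet.isUnit).isSymmetrizable
      (hconn.cayley hdet.isUnit)
  refine ⟨d, hd, ?_⟩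
  have hcA := mul_mul_conjTranspose_eq_of_cayley hdet.isUnit hsymm
  rwa [conjTranspose_smul, smul_mul_assoc, smul_mul_assoc, mul_smul_comm, smul_smul,
    Complex.star_def, Complex.mul_conj, Complex.normSq_eq_norm_sq, hc1, one_pow,
    Complex.ofReal_one, one_smul] at hcA

end Cayley

section Hurwitz

open Metric

theorem le_norm_center_of_forall_mem_sphere_le_norm {f : ℂ → ℂ} {c : ℂ} {r ε : ℝ} (hr : 0 < r)
    (hε : 0 < ε) (hf : DiffContOnCl ℂ f (ball c r)) (hne : ∀ z ∈ closedBall c r, f z ≠ 0)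
    (hle : ∀ z ∈ sphere c r, ε ≤ ‖f z‖) : ε ≤ ‖f c‖ := by
  rw [← closure_ball c hr.ne'] at hne
  rw [← frontier_ball c hr.ne'] at hle
  have hc := subset_closure (mem_ball_self (x := c) hr)
  have hinv : ‖(f c)⁻¹‖ ≤ ε⁻¹ :=
    Complex.norm_le_of_forall_mem_frontier_norm_le isBounded_ball (hf.inv hne)
      (fun z hz => by
        rw [Pi.inv_apply, norm_inv]
        exact inv_anti₀ hε (hle z hz)) hc
  rw [norm_inv] at hinv
  exact (inv_le_inv₀ (norm_pos_iff.2 (hne c hc)) hε).1 hinv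

/-- A form of Hurwitz's theorem. -/
theorem ne_zero_of_frequently_forall_ne_zero {P : Type*} [TopologicalSpace P] {G : P → ℂ → ℂ}
    {U : Set ℂ} (hU : IsOpen U) (hUc : IsPreconnected U) (hG : Continuous (Function.uncurry G))
    (hd : ∀ p, DifferentiableOn ℂ (G p) U) {p₀ : P} (hne : ∃ s ∈ U, G p₀ s ≠ 0)
    (h : ∃ᶠ p in 𝓝 p₀, ∀ s ∈ U, G p s ≠ 0) {s₀ : ℂ} (hs₀ : s₀ ∈ U) : G p₀ s₀ ≠ 0 := by
  intro h0
  have hisolated : ∀ᶠ s in 𝓝[≠] s₀, G p₀ s ≠ 0 := by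
    have han : AnalyticOnNhd ℂ (G p₀) U := (hd p₀).analyticOnNhd hU
    refine (han s₀ hs₀).eventually_eq_zero_or_eventually_ne_zero.resolve_left fun hev => ?_
    obtain ⟨s, hsU, hs⟩ := hne
    exact hs (han.eqOn_zero_of_preconnected_of_eventuallyEq_zero hUc hs₀ hev hsU)
  obtain ⟨r, hr, hball⟩ : ∃ r > 0, closedBall s₀ r ⊆ {s | s ∈ U ∧ (s ≠ s₀ → G p₀ s ≠ 0)} :=
    nhds_basis_closedBall.mem_iff.1
      (Filter.Eventually.and (hU.mem_nhds hs₀) (eventually_nhdsWithin_iff.1 hisolated))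
  obtain ⟨s₁, hs₁, hmin⟩ := (isCompact_sphere s₀ r).exists_isMinOn
    (NormedSpace.sphere_nonempty.2 hr.le) (f := fun s => ‖G p₀ s‖)
    (hG.uncurry_left p₀).norm.continuousOn
  have hm : 0 < ‖G p₀ s₁‖ :=
    norm_pos_iff.2 ((hball (sphere_subset_closedBall hs₁)).2 (ne_of_mem_sphere hs₁ hr.ne'))
  set m := ‖G p₀ s₁‖
  have hsphere : ∀ᶠ p in 𝓝 p₀, ∀ s ∈ sphere s₀ r, m / 2 < ‖G p s‖ :=
    (isCompact_sphere s₀ r).eventually_forall_of_forall_eventually fun s hs =>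
      hG.norm.continuousAt.eventually_const_lt ((half_lt_self hm).trans_le (hmin hs))
  have hcenter : ∀ᶠ p in 𝓝 p₀, ‖G p s₀‖ < m / 2 := by
    refine (hG.uncurry_right s₀).norm.continuousAt.eventually_lt_const ?_
    simpa only [h0, norm_zero] using half_pos hm
  obtain ⟨p, hp, hp_sphere, hp_center⟩ := (h.and_eventually (hsphere.and hcenter)).exists
  have hU' : closedBall s₀ r ⊆ U := fun s hs => (hball hs).1
  refine hp_center.not_ge <| le_norm_center_of_forall_mem_sphere_le_norm hr (half_pos hm)
    (((hd p).mono hU').diffContOnCl_ball subset_rfl) ?_ fun s hs => (hp_sphere s hs).le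
  exact fun s hs => hp s (hU' hs)

end Hurwitz

section Delays

variable {ι : Type*} [Fintype ι] [DecidableEq ι] {A : Matrix ι ι ℂ}

/-- `A` is delay stable if, for all positive integer delays, its generalized characteristic
polynomial has no zeros in the open unit disc. -/
def IsDelayStable (A : Matrix ι ι ℂ) : Prop :=
  ∀ m : ι → ℕ, (∀ i, 0 < m i) → ∀ z : ℂ, ‖z‖ < 1 → (diagonal (fun i => z ^ m i) - A).det ≠ 0

/-- The value of `det (diag z - A)` at the point of the polydisc with `z i = u i * exp (-s * r i)`,
where `p = (r, u)` collects the rates of decay and the phases. Delays `m` and `z = exp (-s)` give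
`r = m` and `u = 1`, but here the rates need not be integers. -/
noncomputable def decayDet (A : Matrix ι ι ℂ) (p : (ι → ℝ) × (ι → ℂ)) (s : ℂ) : ℂ :=
  (diagonal (fun i => p.2 i * Complex.exp (-(s * p.1 i))) - A).det

/-- `p = (r, u)` is a stable parameter for `A` if `decayDet A p` has no zeros in the right half
plane. -/
def IsDecayStable (A : Matrix ι ι ℂ) (p : (ι → ℝ) × (ι → ℂ)) : Prop :=
  ∀ s : ℂ, 0 < s.re → decayDet A p s ≠ 0

theorem differentiable_det_diagonal_sub (A : Matrix ι ι ℂ) {w : ℂ → ι → ℂ}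
    (hw : ∀ i, Differentiable ℂ fun s => w s i) :
    Differentiable ℂ fun s => (diagonal (w s) - A).det := by
  simp only [det_apply]
  refine Differentiable.fun_sum fun σ _ => Differentiable.const_smul ?_ _
  refine Differentiable.fun_finsetProd fun i _ => ?_
  rcases eq_or_ne (σ i) i with hi | hi
  · simpa only [Matrix.sub_apply, hi, diagonal_apply_eq] using (hw i).sub_const (A i i)
  · simp only [Matrix.sub_apply, diagonal_apply_ne _ hi, differentiable_const]

theorem continuous_uncurry_decayDet (A : Matrix ι ι ℂ) :
    Continuous (Function.uncurry (decayDet A)) := by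
  refine Continuous.matrix_det (Continuous.sub (Continuous.matrix_diagonal ?_) continuous_const)
  fun_prop

theorem differentiable_decayDet (A : Matrix ι ι ℂ) (p : (ι → ℝ) × (ι → ℂ)) :
    Differentiable ℂ (decayDet A p) :=
  differentiable_det_diagonal_sub A fun i => by fun_prop

theorem tendsto_decayDet_atTop (A : Matrix ι ι ℂ) {p : (ι → ℝ) × (ι → ℂ)} (hp : ∀ i, 0 < p.1 i) :
    Tendsto (fun t : ℝ => decayDet A p t) atTop (𝓝 (-A).det) := by
  have hexp (i : ι) : Tendsto (fun t : ℝ => p.2 i * Complex.exp (-(t * p.1 i))) atTop (𝓝 0) := by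
    have hre : Tendsto (fun t : ℝ => (-((t : ℂ) * p.1 i)).re) atTop atBot := by
      simp only [← Complex.ofReal_mul, ← Complex.ofReal_neg, Complex.ofReal_re]
      exact tendsto_neg_atTop_atBot.comp (tendsto_id.atTop_mul_const (hp i))
    simpa only [mul_zero] using
      (tendsto_const_nhds (x := p.2 i)).mul (Complex.tendsto_exp_nhds_zero_iff.2 hre)
  have hdet : Continuous fun w : ι → ℂ => (diagonal w - A).det :=
    (continuous_id.matrix_diagonal.sub continuous_const).matrix_det
  rw [← zero_sub A, ← diagonal_zero']
  exact (hdet.tendsto 0).comp (tendsto_pi_nhds.2 hexp)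

theorem IsDecayStable.of_frequently (hA : A.det ≠ 0) {p : (ι → ℝ) × (ι → ℂ)}
    (hp : ∀ i, 0 < p.1 i) (h : ∃ᶠ q in 𝓝 p, IsDecayStable A q) : IsDecayStable A p := by
  have hne : ∃ s ∈ {s : ℂ | 0 < s.re}, decayDet A p s ≠ 0 := by
    have hA' : (-A).det ≠ 0 := by
      rw [det_neg]
      exact mul_ne_zero (pow_ne_zero _ (neg_ne_zero.2 one_ne_zero)) hA
    obtain ⟨t, ht, ht0⟩ := (((tendsto_decayDet_atTop A hp).eventually_ne hA').and
      (eventually_gt_atTop 0)).exists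
    exact ⟨t, ht0, ht⟩
  exact fun s hs => ne_zero_of_frequently_forall_ne_zero
    (isOpen_lt continuous_const Complex.continuous_re) (convex_halfSpace_re_gt 0).isPreconnected
    (continuous_uncurry_decayDet A) (fun q => (differentiable_decayDet A q).differentiableOn)
    hne h hs

theorem IsDelayStable.det_ne_zero (h : IsDelayStable A) : A.det ≠ 0 := by
  have h0 := h 1 (fun _ => one_pos) 0 (norm_zero.trans_lt one_pos)
  simp only [Pi.one_apply, pow_one, diagonal_zero, zero_sub, det_neg] at h0
  exact right_ne_zero_of_mul h0

theorem IsDelayStable.isDecayStable (h : IsDelayStable A) {m : ι → ℕ} (hm : ∀ i, 0 < m i)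
    {a : ℝ} (ha : 0 < a) (b : ℝ) :
    IsDecayStable A (fun i => m i * a, fun i => Complex.exp (m i * (b * Complex.I))) := by
  intro s hs
  have hnorm : ‖Complex.exp (b * Complex.I - s * a)‖ < 1 := by
    rw [Complex.norm_exp, Real.exp_lt_one_iff, Complex.sub_re, Complex.re_ofReal_mul,
      Complex.I_re, mul_zero, Complex.re_mul_ofReal, zero_sub]
    exact neg_neg_of_pos (mul_pos hs ha)
  rw [decayDet]
  convert h m hm _ hnorm using 5 with i
  rw [← Complex.exp_nat_mul, ← Complex.exp_add]
  push_cast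
  congr 1
  ring

/-- The delay approximating a rate `r` and a phase `exp (2 * π * τ * I)` at resolution `q`: divided
by `q ^ 2` it is close to `r`, while its residue modulo `q`, divided by `q`, is close to `τ`. -/
noncomputable def approxDelay (r τ : ℝ) (q : ℕ) : ℕ :=
  q * (⌊r * q⌋₊ + 1) + ⌊τ * q⌋₊

theorem approxDelay_pos (r τ : ℝ) {q : ℕ} (hq : 0 < q) : 0 < approxDelay r τ q :=
  Nat.add_pos_left (Nat.mul_pos hq (Nat.succ_pos _)) _

theorem tendsto_approxDelay_mul {r τ : ℝ} (hr : 0 ≤ r) (hτ : 0 ≤ τ) :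
    Tendsto (fun q : ℕ => approxDelay r τ q * ((q : ℝ) ^ 2)⁻¹) atTop (𝓝 r) := by
  have hfloor {t : ℝ} (ht : 0 ≤ t) : Tendsto (fun q : ℕ => (⌊t * q⌋₊ : ℝ) / q) atTop (𝓝 t) :=
    (tendsto_nat_floor_mul_div_atTop ht).comp tendsto_natCast_atTop_atTop
  have hinv : Tendsto (fun q : ℕ => (q : ℝ)⁻¹) atTop (𝓝 0) := tendsto_inv_atTop_nhds_zero_nat
  have hsum := ((hfloor hr).add hinv).add ((hfloor hτ).mul hinv)
  rw [mul_zero, add_zero, add_zero] at hsum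
  refine hsum.congr' ((eventually_ne_atTop 0).mono fun q hq => ?_)
  have hq' : (q : ℝ) ≠ 0 := Nat.cast_ne_zero.2 hq
  simp only [approxDelay]
  push_cast
  field_simp

theorem exp_approxDelay_mul (r τ : ℝ) {q : ℕ} (hq : q ≠ 0) :
    Complex.exp (approxDelay r τ q * ((2 * Real.pi / q : ℝ) * Complex.I)) =
      Complex.exp ((⌊τ * q⌋₊ / q : ℝ) * (2 * Real.pi * Complex.I)) := by
  have hq' : (q : ℂ) ≠ 0 := Nat.cast_ne_zero.2 hq
  rw [← mul_one (Complex.exp ((_ / _ : ℝ) * (_ * Complex.I))),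
    ← Complex.exp_nat_mul_two_pi_mul_I (⌊r * q⌋₊ + 1), ← Complex.exp_add, approxDelay]
  push_cast
  congr 1
  field_simp
  ring

theorem exists_nonneg_exp_mul_eq {u : ℂ} (hu : ‖u‖ = 1) :
    ∃ τ : ℝ, 0 ≤ τ ∧ Complex.exp (τ * (2 * Real.pi * Complex.I)) = u := by
  have hpi : (Real.pi : ℂ) ≠ 0 := Complex.ofReal_ne_zero.2 Real.pi_ne_zero
  refine ⟨(u.arg + 2 * Real.pi) / (2 * Real.pi), ?_, ?_⟩
  · have harg := Complex.neg_pi_lt_arg u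
    have := Real.pi_pos
    exact div_nonneg (by linarith) (by linarith)
  · have hexp : ((u.arg + 2 * Real.pi) / (2 * Real.pi) : ℝ) * (2 * Real.pi * Complex.I)
        = u.arg * Complex.I + 2 * Real.pi * Complex.I := by
      push_cast
      field_simp
    rw [hexp, Complex.exp_add, Complex.exp_two_pi_mul_I, mul_one]
    simpa only [hu, Complex.ofReal_one, one_mul] using Complex.norm_mul_exp_arg_mul_I u

theorem IsDelayStable.isDecayStable_of_norm_eq_one (h : IsDelayStable A) {r : ι → ℝ} {u : ι → ℂ}
    (hr : ∀ i, 0 < r i) (hu : ∀ i, ‖u i‖ = 1) : IsDecayStable A (r, u) := by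
  choose τ hτ hexp using fun i => exists_nonneg_exp_mul_eq (hu i)
  let m (q : ℕ) (i : ι) : ℕ := approxDelay (r i) (τ i) q
  let p (q : ℕ) : (ι → ℝ) × (ι → ℂ) := (fun i => m q i * ((q : ℝ) ^ 2)⁻¹,
    fun i => Complex.exp (m q i * ((2 * Real.pi / q : ℝ) * Complex.I)))
  have hstable : ∀ᶠ q in atTop, IsDecayStable A (p q) := by
    filter_upwards [eventually_gt_atTop 0] with q hq
    exact h.isDecayStable (fun i => approxDelay_pos _ _ hq)
      (inv_pos.2 (pow_pos (Nat.cast_pos.2 hq) 2)) _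
  have hphase (i : ι) : Tendsto (fun q => (p q).2 i) atTop (𝓝 (u i)) := by
    have hcont : Continuous fun t : ℝ => Complex.exp (t * (2 * Real.pi * Complex.I)) := by
      fun_prop
    have hfloor := (tendsto_nat_floor_mul_div_atTop (hτ i)).comp tendsto_natCast_atTop_atTop
    rw [← hexp i]
    refine ((hcont.tendsto (τ i)).comp hfloor).congr' ?_
    filter_upwards [eventually_ne_atTop 0] with q hq
    exact (exp_approxDelay_mul _ _ hq).symm
  have hp : Tendsto p atTop (𝓝 (r, u)) := (tendsto_pi_nhds.2 fun i =>
    tendsto_approxDelay_mul (hr i).le (hτ i)).prodMk_nhds (tendsto_pi_nhds.2 hphase)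
  exact .of_frequently h.det_ne_zero hr (hp.frequently hstable.frequently)

theorem IsDelayStable.det_diagonal_sub_ne_zero (h : IsDelayStable A) {z : ι → ℂ}
    (h0 : ∀ i, z i ≠ 0) (h1 : ∀ i, ‖z i‖ < 1) : (diagonal z - A).det ≠ 0 := by
  have hpolar (i : ι) :
      z i / ‖z i‖ * Complex.exp (-(1 * (-Real.log ‖z i‖ : ℝ))) = z i := by
    have hz : (‖z i‖ : ℂ) ≠ 0 := Complex.ofReal_ne_zero.2 (norm_ne_zero_iff.2 (h0 i))
    rw [one_mul, ← Complex.ofReal_neg, neg_neg, ← Complex.ofReal_exp,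
      Real.exp_log (norm_pos_iff.2 (h0 i)), div_mul_cancel₀ _ hz]
  have hstable : IsDecayStable A (fun i => -Real.log ‖z i‖, fun i => z i / ‖z i‖) :=
    h.isDecayStable_of_norm_eq_one
      (fun i => neg_pos.2 (Real.log_neg (norm_pos_iff.2 (h0 i)) (h1 i)))
      fun i => by rw [norm_div, Complex.norm_real, norm_norm, div_self (norm_ne_zero_iff.2 (h0 i))]
  simpa only [decayDet, hpolar] using hstable 1 (Complex.one_re ▸ one_pos)

theorem IsDelayStable.isPolydiscStable (h : IsDelayStable A) : IsPolydiscStable A := by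
  intro z hz
  obtain ⟨t, ht, htz⟩ : ∃ t : ℝ, 0 < t ∧ ∀ i, ‖Complex.exp t * z i‖ < 1 := by
    have hlim (i : ι) : ∀ᶠ t : ℝ in 𝓝 0, ‖Complex.exp t * z i‖ < 1 :=
      Tendsto.eventually_lt_const (v := ‖Complex.exp (0 : ℝ) * z i‖)
        (by simpa only [Complex.ofReal_zero, Complex.exp_zero, one_mul] using hz i)
        (Continuous.tendsto (by fun_prop) _)
    have hright := (eventually_all.2 hlim).filter_mono (nhdsWithin_le_nhds (s := Set.Ioi 0))
    exact (eventually_mem_nhdsWithin.and hright).exists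
  let u : ι → ℂ := fun i => Complex.exp t * z i
  have hdense : ∃ᶠ w in 𝓝 u, ∀ i, w i ≠ 0 := by
    have := mem_closure_iff_frequently.1
      (dense_pi Set.univ (fun i _ => dense_compl_singleton (0 : ℂ)) u)
    simpa only [Set.mem_univ_pi, Set.mem_compl_singleton_iff] using this
  have hnorm : ∀ᶠ w in 𝓝 u, ∀ i, ‖w i‖ < 1 := eventually_all.2 fun i =>
    (continuous_apply i).norm.continuousAt.eventually_lt_const (htz i)
  have hfreq : ∃ᶠ w in 𝓝 u, IsDecayStable A (fun _ => t, w) := by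
    refine (hdense.and_eventually hnorm).mono fun w hw s hs => ?_
    refine h.det_diagonal_sub_ne_zero (fun i => mul_ne_zero (hw.1 i) (Complex.exp_ne_zero _))
      fun i => ?_
    rw [norm_mul, Complex.norm_exp]
    refine mul_lt_one_of_nonneg_of_lt_one_left (norm_nonneg _) (hw.2 i) ?_
    rw [Real.exp_le_one_iff, Complex.neg_re, Complex.re_mul_ofReal]
    exact neg_nonpos.2 (mul_pos hs ht).le
  have hstable : IsDecayStable A (fun _ => t, u) := .of_frequently h.det_ne_zero (fun _ => ht)
    ((Continuous.prodMk_right _).tendsto u |>.frequently hfreq)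
  have hcancel (i : ι) : u i * Complex.exp (-(1 * t)) = z i := by
    rw [one_mul, mul_right_comm, ← Complex.exp_add, add_neg_cancel, Complex.exp_zero, one_mul]
  simpa only [decayDet, hcancel] using hstable 1 (Complex.one_re ▸ one_pos)

end Delays

section Unilossless

variable {N : ℕ} {A : Matrix (Fin N) (Fin N) ℂ}

theorem eval_genCharPoly (A : Matrix (Fin N) (Fin N) ℂ) (m : Fin N → ℕ) (z : ℂ) :
    (genCharPoly A m).eval z = (diagonal (fun i => z ^ m i) - A).det := by
  rw [genCharPoly, ← Polynomial.coe_evalRingHom, RingHom.map_det]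
  congr 1
  ext i j
  rcases eq_or_ne i j with rfl | hij
  · simp
  · simp [hij]

theorem IsUnilossless.det_ne_zero (h : IsUnilossless A) {m : Fin N → ℕ} (hm : ∀ i, 0 < m i)
    {z : ℂ} (hz : ‖z‖ ≠ 1) : (diagonal (fun i => z ^ m i) - A).det ≠ 0 := by
  rw [← eval_genCharPoly]
  exact fun h0 => hz (h m hm z h0)

theorem IsUnilossless.isDelayStable (h : IsUnilossless A) : IsDelayStable A :=
  fun _ hm _ hz => h.det_ne_zero hm hz.ne

theorem IsUnilossless.isDelayStable_inv (h : IsUnilossless A) : IsDelayStable A⁻¹ := by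
  intro m hm z hz
  have hA : IsUnit A.det := h.isDelayStable.det_ne_zero.isUnit
  have hAinv : (A⁻¹).det ≠ 0 := (A.isUnit_nonsing_inv_det hA).ne_zero
  rcases eq_or_ne z 0 with rfl | hz0
  · simp only [zero_pow (hm _).ne', diagonal_zero, zero_sub, det_neg]
    exact mul_ne_zero (pow_ne_zero _ (neg_ne_zero.2 one_ne_zero)) hAinv
  · have hinv : ‖z⁻¹‖ ≠ 1 := by
      rw [norm_inv]
      exact (inv_eq_one.not).2 hz.ne
    have hfac : diagonal (fun i => z⁻¹ ^ m i) - A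
        = -(diagonal (fun i => z⁻¹ ^ m i) * (diagonal (fun i => z ^ m i) - A⁻¹) * A) := by
      simp only [mul_sub, sub_mul, diagonal_mul_diagonal, ← mul_pow, inv_mul_cancel₀ hz0, one_pow,
        diagonal_one, one_mul, mul_assoc, nonsing_inv_mul A hA, mul_one, neg_sub]
    have hdet := h.det_ne_zero hm hinv
    rw [hfac, det_neg, det_mul, det_mul] at hdet
    exact right_ne_zero_of_mul (left_ne_zero_of_mul (right_ne_zero_of_mul hdet))

theorem IsIrreducible.isStronglyConnected (h : IsIrreducible A) : IsStronglyConnected A := by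
  classical
  intro S hS h0
  by_contra hne
  obtain ⟨i, hi⟩ := hS
  obtain ⟨j, hj⟩ := (Set.ne_univ_iff_exists_notMem S).1 hne
  let e : Fin (Fintype.card {x // x ∉ S}) ⊕ Fin (Fintype.card {x // ¬ x ∉ S}) ≃ Fin N :=
    (Equiv.sumCongr (Fintype.equivFin _).symm (Fintype.equivFin _).symm).trans
      (Equiv.sumCompl fun x => x ∉ S)
  have hblock : (A.submatrix e e).toBlocks₂₁ = 0 := by
    ext x y
    exact h0 _ (not_not.1 ((Fintype.equivFin {x // ¬ x ∉ S}).symm x).2) _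
      ((Fintype.equivFin {x // x ∉ S}).symm y).2
  refine h ⟨_, _, Fintype.card_pos_iff.2 ⟨⟨j, hj⟩⟩, Fintype.card_pos_iff.2 ⟨⟨i, not_not.2 hi⟩⟩, e,
    (A.submatrix e e).toBlocks₁₁, (A.submatrix e e).toBlocks₁₂, (A.submatrix e e).toBlocks₂₂, ?_⟩
  rw [← hblock, fromBlocks_toBlocks]

end Unilossless

end FDN

theorem theorem8 {N : ℕ} (A : Matrix (Fin N) (Fin N) ℂ)
    (hirr : FDN.IsIrreducible A) (huni : FDN.IsUnilossless A) :
    ∃ E : Matrix (Fin N) (Fin N) ℂ,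
      E.IsDiag ∧ IsUnit E ∧ A * E * A.conjTranspose = E := by
  obtain ⟨d, hd, hA⟩ := huni.isDelayStable.isPolydiscStable.exists_mul_mul_conjTranspose_eq
    huni.isDelayStable_inv.isPolydiscStable hirr.isStronglyConnected
  refine ⟨Matrix.diagonal d, Matrix.isDiag_diagonal d, ?_, hA⟩
  rw [Matrix.isUnit_iff_isUnit_det, Matrix.det_diagonal, isUnit_iff_ne_zero]
  exact Finset.prod_ne_zero_iff.2 fun i _ => hd i
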